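/- Let $\mathcal A$ be a finite alphabet. A \emph{PDF0L system} is a triple $S=(\mathcal A,\varphi,W)$ where $\varphi\colon\mathcal A^*\to\mathcal A^*$ is a morphism with $\varphi(a)\neq\varepsilon$ for all $a\in\mathcal A$, and $W\subseteq\mathcal A^+$ is a non-empty finite set of non-empty words. Its language $\mathcal L(S)$ is the set of all factors of the words $\varphi^k(w)$ with $k\ge 0$, $w\in W$. For $n\ge1$ the $n$-th power of $S$ is the PDF0L system \[ S^n=(\mathcal A,\varphi^n,\{\varphi^i(w) : w\in W,\ 0\le i<n\}). \] An \emph{interpretation} of a word $u$ in $S$ is a triple $(s,w,t)$ of words with $w\in\mathcal L(S)$ and $\varphi(w)=sut$. A pair $(u',u'')$ is \emph{compatible} with an interpretation $(s,w,t)$ of $u'u''$ if $w=w'w''$ for some words $w',w''$ with $\varphi(w')=su'$ and $\varphi(w'')=u''t$. The pair is \emph{admissible} if it is compatible with at least one interpretation of $u'u''$, and \emph{weakly synchronizing} if it is compatible with all interpretations of $u'u''$; in the latter case the word $u'u''$ is called \emph{weakly synchronized}. A pair $(u',u'')$ with $u'\ne\varepsilon$ is \emph{strongly synchronizing} if there is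 a letter $a\in\mathcal A$ such that for every interpretation $(s,w,t)$ of $u'u''$ there are words $w',w''$ with $w=w'w''$, $\varphi(w')=su'$, $\varphi(w'')=u''t$, and $w'$ ends with $a$. The system $S$ is \emph{weakly circular} if there is an integer $D\ge0$ such that every $u\in\mathcal L(S)$ with $|u|>D$ is weakly synchronized. It is \emph{strongly circular} if there is an integer $D'\ge0$ such that every admissible pair $(u',u'')$ with $|u'|>D'$ and $|u''|>D'$ is strongly synchronizing. \textbf{Corollary.} If a PDF0L system $S$ is strongly circular, then for every $n\ge1$ the power $S^n$ is weakly circular. -/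

import Mathlib

/-- A DF0L system over the alphabet `A`: a morphism `φ : A* → A*` together with a non-empty finite
set of non-empty words, the axioms. (`1 : FreeMonoid A` is the empty word, multiplication is
concatenation, and powers in `Monoid.End` are iterates.) -/
structure DF0LSystem (A : Type*) where
  φ : Monoid.End (FreeMonoid A)
  axs : Set (FreeMonoid A)
  axs_finite : axs.Finite
  axs_nonempty : axs.Nonempty
  ne_one_of_mem_axs : ∀ w ∈ axs, w ≠ 1

namespace DF0LSystem

variable {A : Type*} (S : DF0LSystem A)

/-- The language of `S`: all factors of the words `φ^k(w)`, with `k ≥ 0` and `w` an axiom. -/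
def lang : Set (FreeMonoid A) :=
  {u | ∃ k : ℕ, ∃ w ∈ S.axs, ∃ p q : FreeMonoid A, (S.φ ^ k) w = p * u * q}

/-- `(s, w, t)` is an interpretation of `u` in `S`. -/
def IsInterpretation (u s w t : FreeMonoid A) : Prop :=
  S.φ w = s * u * t ∧ w ∈ S.lang

/-- The pair `(u', u'')` is compatible with `(s, w, t)`. -/
def IsCompatible (u' u'' s w t : FreeMonoid A) : Prop :=
  ∃ w' w'' : FreeMonoid A, w' * w'' = w ∧ S.φ w' = s * u' ∧ S.φ w'' = u'' * t

/-- The pair `(u', u'')` is compatible with at least one interpretation of `u'u''`. -/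
def IsAdmissible (u' u'' : FreeMonoid A) : Prop :=
  ∃ s w t : FreeMonoid A, S.IsInterpretation (u' * u'') s w t ∧ S.IsCompatible u' u'' s w t

/-- The pair `(u', u'')` is compatible with all interpretations of `u'u''`. -/
def IsWeaklySynchronizing (u' u'' : FreeMonoid A) : Prop :=
  ∀ s w t : FreeMonoid A, S.IsInterpretation (u' * u'') s w t → S.IsCompatible u' u'' s w t

/-- The word `u` can be cut into a weakly synchronizing pair. -/
def IsWeaklySynchronized (u : FreeMonoid A) : Prop :=
  ∃ u' u'' : FreeMonoid A, u = u' * u'' ∧ S.IsWeaklySynchronizing u' u''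

/-- The pair `(u', u'')`, with `u'` non-empty, is compatible with all interpretations of `u'u''`,
through words `w'` which all end with one and the same letter `a`. -/
def IsStronglySynchronizing (u' u'' : FreeMonoid A) : Prop :=
  u' ≠ 1 ∧ ∃ a : A, ∀ s w t : FreeMonoid A, S.IsInterpretation (u' * u'') s w t →
    ∃ w' w'' : FreeMonoid A, w = w' * w'' ∧ S.φ w' = s * u' ∧ S.φ w'' = u'' * t ∧
      ∃ x : FreeMonoid A, w' = x * FreeMonoid.of a

/-- All long enough words of the language are weakly synchronized. -/
def IsWeaklyCircular : Prop :=
  ∃ D : ℕ, ∀ u ∈ S.lang, D < u.length → S.IsWeaklySynchronized u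

/-- All admissible pairs of long enough words are strongly synchronizing. -/
def IsStronglyCircular : Prop :=
  ∃ D : ℕ, ∀ u' u'' : FreeMonoid A, S.IsAdmissible u' u'' → D < u'.length → D < u''.length →
    S.IsStronglySynchronizing u' u''

end DF0LSystem

/-- A PDF0L system: a DF0L system whose morphism is non-erasing. -/
structure PDF0LSystem (A : Type*) extends DF0LSystem A where
  nonerasing : ∀ a : A, φ (FreeMonoid.of a) ≠ 1

namespace PDF0LSystem

variable {A : Type*} (S : PDF0LSystem A)

theorem map_ne_one (w : FreeMonoid A) (hw : w ≠ 1) : S.φ w ≠ 1 := by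
  induction w using FreeMonoid.casesOn with
  | one => exact absurd rfl hw
  | of_mul a v =>
    intro h
    rw [map_mul] at h
    have h2 := congrArg FreeMonoid.length h
    rw [FreeMonoid.length_mul, FreeMonoid.length_one] at h2
    exact S.nonerasing a (FreeMonoid.length_eq_zero.mp (by omega))

theorem pow_map_ne_one (k : ℕ) (w : FreeMonoid A) (hw : w ≠ 1) : (S.φ ^ k) w ≠ 1 := by
  induction k with
  | zero => simpa using hw
  | succ k ih =>
    rw [pow_succ']
    exact S.map_ne_one _ ih

/-- The power `S^n = (A, φ^n, {φ^i(w) | w ∈ W, 0 ≤ i < n})`, for `n ≥ 1`. -/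
def power (n : ℕ) (hn : 1 ≤ n) : PDF0LSystem A where
  φ := S.φ ^ n
  axs := {x | ∃ w ∈ S.axs, ∃ i : ℕ, i < n ∧ x = (S.φ ^ i) w}
  axs_finite := by
    refine ((S.axs_finite.prod (Set.finite_lt_nat n)).image
      (fun y => (S.φ ^ y.2) y.1)).subset ?_
    rintro x ⟨w, hw, i, hi, rfl⟩
    exact ⟨(w, i), ⟨hw, hi⟩, rfl⟩
  axs_nonempty := by
    obtain ⟨w, hw⟩ := S.axs_nonempty
    exact ⟨(S.φ ^ 0) w, w, hw, 0, hn, rfl⟩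
  ne_one_of_mem_axs := by
    rintro x ⟨w, hw, i, _, rfl⟩
    exact S.pow_map_ne_one i w (S.ne_one_of_mem_axs w hw)
  nonerasing := fun a => S.pow_map_ne_one n _ (FreeMonoid.of_ne_one a)

end PDF0LSystem

/-!
Strong circularity lets one desubstitute a long word uniquely, up to its two ends. Fix an
interpretation `(p, W, q)` of a long word `u`. Every cut of `W` whose image lies more than `D`
letters inside `u` gives an admissible pair, hence a strongly synchronizing one: every
interpretation `(s, w, t)` of `u` has a cut at the same place of `u`, preceded by the same letter.
As the morphism is non-erasing, a cut is determined by its place, so these letters are consecutive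
in `w`, and the whole inner part `v` of `W` occurs in `w`. Thus `u = u₁ φ(v) u₃` and every
interpretation of `u` has the form `(s, x v y, t)` with `φ(x) = s u₁` and `φ(y) = u₃ t`
(`PDF0LSystem.exists_common_desubstitution`).

The corollary follows by induction on `n`, starting at the trivial case `n = 0`
(`PDF0LSystem.exists_synchronizing_cut_pow`). If `φ^(n+1)(w) = s u t`, then `φ^n(w)` interprets `u`
in `S`, so `φ^n(w) = x v y` and `(x, w, y)` interprets `v` with respect to `φ^n`. A synchronizing
cut `v = v' v''` for `φ^n` therefore gives the synchronizing cut `(u₁ φ(v'), φ(v'') u₃)` of `u` for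
`φ^(n+1)`.
-/

namespace FreeMonoid

variable {A : Type*}

theorem exists_eq_mul_of_mul_eq_mul {a b c d : FreeMonoid A} (h : a * b = c * d)
    (hl : c.length ≤ a.length) : ∃ e, a = c * e ∧ d = e * b := by
  rcases List.append_eq_append_iff.mp (show a.toList ++ b.toList = c.toList ++ d.toList from h)
    with ⟨e, h1, h2⟩ | ⟨e, h1, h2⟩
  · have hlen : c.length = a.length + e.length := by
      simpa [FreeMonoid.length] using congrArg List.length h1
    obtain rfl : e = [] := List.length_eq_zero_iff.mp (by omega)
    exact ⟨1, by simpa using h1.symm, by simpa using h2.symm⟩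
  · exact ⟨ofList e, h1, h2⟩

theorem exists_length_map_le [Finite A] (f : Monoid.End (FreeMonoid A)) :
    ∃ M : ℕ, (∀ a, (f (of a)).length ≤ M) ∧ ∀ w, (f w).length ≤ M * w.length := by
  obtain ⟨M, hM⟩ := (Set.finite_range fun a => (f (of a)).length).bddAbove
  have hM' : ∀ a, (f (of a)).length ≤ M := fun a => hM ⟨a, rfl⟩
  refine ⟨M, hM', fun w => ?_⟩
  induction w using FreeMonoid.inductionOn' with
  | one => simp
  | of_mul a w ih =>
    rw [map_mul, length_mul, length_mul, length_of, mul_add]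
    have := hM' a
    omega

/-- The images of the prefixes of `w` grow by at most `M` letters at a time. -/
theorem exists_cut_of_le_length_map (f : Monoid.End (FreeMonoid A)) {M : ℕ}
    (hM : ∀ a, (f (of a)).length ≤ M) (w : FreeMonoid A) (d : ℕ) (hd : d ≤ (f w).length) :
    ∃ x y, w = x * y ∧ d ≤ (f x).length ∧ (f x).length ≤ d + M := by
  induction w using FreeMonoid.inductionOn' generalizing d with
  | one => exact ⟨1, 1, by simp, hd, by simp⟩
  | of_mul a w ih =>
    rw [map_mul, length_mul] at hd
    rcases Nat.eq_zero_or_pos d with rfl | hpos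
    · exact ⟨1, _, (one_mul _).symm, by simp, by simp⟩
    have ha := hM a
    obtain ⟨x, y, rfl, h1, h2⟩ := ih (d - (f (of a)).length) (by omega)
    by_cases hda : d ≤ (f (of a)).length
    · exact ⟨of a, x * y, rfl, hda, by omega⟩
    · refine ⟨of a * x, y, (mul_assoc _ _ _).symm, ?_, ?_⟩ <;>
        rw [map_mul, length_mul] <;> omega

end FreeMonoid

namespace PDF0LSystem

variable {A : Type*} (S : PDF0LSystem A)

/-- A cut of a word is determined by the image of its left part, because `φ` is non-erasing. -/
theorem left_eq_of_map_eq {a b c d : FreeMonoid A} (h : a * b = c * d) (hm : S.φ a = S.φ c) :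
    a = c := by
  have key : ∀ {a b c d : FreeMonoid A}, a * b = c * d → S.φ a = S.φ c → c.length ≤ a.length →
      a = c := by
    intro a b c d h hm hl
    obtain ⟨e, rfl, -⟩ := FreeMonoid.exists_eq_mul_of_mul_eq_mul h hl
    rw [map_mul, mul_eq_left] at hm
    by_cases he : e = 1
    · rw [he, mul_one]
    · exact absurd hm (S.map_ne_one e he)
  rcases le_total c.length a.length with hl | hl
  · exact key h hm hl
  · exact (key h.symm hm.symm hl).symm

theorem mem_lang_of_mul_mul_mem {x v y : FreeMonoid A} (h : x * v * y ∈ S.lang) : v ∈ S.lang := by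
  obtain ⟨k, w, hw, p, q, e⟩ := h
  exact ⟨k, w, hw, p * x, y * q, by simp only [e, mul_assoc]⟩

theorem map_pow_mem_lang {w : FreeMonoid A} (h : w ∈ S.lang) (n : ℕ) :
    (S.φ ^ n) w ∈ S.lang := by
  obtain ⟨k, v, hv, p, q, e⟩ := h
  refine ⟨n + k, v, hv, (S.φ ^ n) p, (S.φ ^ n) q, ?_⟩
  rw [pow_add, Monoid.End.coe_mul, Function.comp_apply, e, map_mul, map_mul]

theorem lang_power_subset (n : ℕ) (hn : 1 ≤ n) : (S.power n hn).lang ⊆ S.lang := by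
  rintro u ⟨k, _, ⟨w, hw, i, -, rfl⟩, p, q, e⟩
  refine ⟨n * k + i, w, hw, p, q, ?_⟩
  rw [pow_add, pow_mul, Monoid.End.coe_mul, Function.comp_apply]
  exact e

theorem exists_isInterpretation_of_length_lt :
    ∃ L : ℕ, ∀ u ∈ S.lang, L < u.length → ∃ p w q, S.IsInterpretation u p w q := by
  obtain ⟨L, hL⟩ := (S.axs_finite.image FreeMonoid.length).bddAbove
  refine ⟨L, ?_⟩
  rintro u ⟨k, w, hw, p, q, e⟩ hu
  cases k with
  | zero =>
    have h1 : w.length ≤ L := hL ⟨w, hw, rfl⟩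
    have h2 : w = p * u * q := by simpa using e
    rw [h2, FreeMonoid.length_mul, FreeMonoid.length_mul] at h1
    omega
  | succ k =>
    rw [pow_succ', Monoid.End.coe_mul, Function.comp_apply] at e
    exact ⟨p, (S.φ ^ k) w, q, e, k, w, hw, 1, 1, by simp⟩

/-- An interpretation of a long word contains a long word `v` whose image stays more than `D`
letters away from both ends. -/
theorem exists_inner_part [Finite A] (D N : ℕ) : ∃ K : ℕ, ∀ u p W q : FreeMonoid A,
    K < u.length → S.φ W = p * u * q →
    ∃ x v y u₁ u₃, W = x * v * y ∧ u = u₁ * S.φ v * u₃ ∧ S.φ x = p * u₁ ∧ S.φ y = u₃ * q ∧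
      N < v.length ∧ D < u₁.length ∧ D < u₃.length := by
  obtain ⟨M, hM, hM'⟩ := FreeMonoid.exists_length_map_le S.φ
  refine ⟨2 * D + 2 + 2 * M + M * N, fun u p W q hu hW => ?_⟩
  have hlen := congrArg FreeMonoid.length hW
  simp only [FreeMonoid.length_mul] at hlen
  obtain ⟨x, y', rfl, hx1, hx2⟩ := FreeMonoid.exists_cut_of_le_length_map S.φ hM W
    (p.length + D + 1) (by omega)
  rw [map_mul, FreeMonoid.length_mul] at hlen
  -- `x * v` shall end at least `D + 1` letters before the end of `u`; the cut may overshoot by `M`.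
  obtain ⟨v, y, rfl, hv1, hv2⟩ := FreeMonoid.exists_cut_of_le_length_map S.φ hM y'
    (p.length + u.length - D - 1 - M - (S.φ x).length) (by omega)
  rw [map_mul, map_mul, mul_assoc p] at hW
  obtain ⟨u₁, hu₁, e⟩ := FreeMonoid.exists_eq_mul_of_mul_eq_mul hW (by omega)
  rw [← mul_assoc] at e
  have hl₁ := congrArg FreeMonoid.length hu₁
  rw [FreeMonoid.length_mul] at hl₁
  obtain ⟨u₃, rfl, hu₃⟩ := FreeMonoid.exists_eq_mul_of_mul_eq_mul e (by
    rw [FreeMonoid.length_mul]; omega)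
  simp only [FreeMonoid.length_mul] at *
  refine ⟨x, v, y, u₁, u₃, (mul_assoc _ _ _).symm, rfl, hu₁, hu₃, ?_, by omega, by omega⟩
  by_contra hN
  have h1 := hM' v
  have h2 := Nat.mul_le_mul_left M (not_lt.mp hN)
  omega

/-- In a strongly circular system, all interpretations of a long word share a long word `v`, which
they contain at the same place. -/
theorem exists_common_desubstitution [Finite A] (hS : S.IsStronglyCircular) (N : ℕ) :
    ∃ K : ℕ, ∀ u ∈ S.lang, K < u.length → ∃ u₁ v u₃, u = u₁ * S.φ v * u₃ ∧ v ∈ S.lang ∧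
      N < v.length ∧ ∀ s w t, S.IsInterpretation u s w t →
        ∃ x y, w = x * v * y ∧ S.φ x = s * u₁ ∧ S.φ y = u₃ * t := by
  obtain ⟨D, hD⟩ := hS
  obtain ⟨L, hL⟩ := S.exists_isInterpretation_of_length_lt
  obtain ⟨K, hK⟩ := S.exists_inner_part D N
  refine ⟨max K L, fun u hu hlen => ?_⟩
  obtain ⟨p, W, q, hW, hWl⟩ := hL u hu (lt_of_le_of_lt (le_max_right _ _) hlen)
  obtain ⟨x₀, v, y₀, u₁, u₃, rfl, rfl, hx₀, hy₀, hN, h₁, h₃⟩ :=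
    hK u p W q (lt_of_le_of_lt (le_max_left _ _) hlen) hW
  refine ⟨u₁, v, u₃, rfl, S.mem_lang_of_mul_mul_mem hWl, hN, ?_⟩
  have sync : ∀ v' v'', v = v' * v'' →
      S.IsStronglySynchronizing (u₁ * S.φ v') (S.φ v'' * u₃) := by
    rintro v' v'' rfl
    refine hD _ _ ⟨p, x₀ * (v' * v'') * y₀, q, ⟨?_, hWl⟩, x₀ * v', v'' * y₀, ?_, ?_, ?_⟩ ?_ ?_
    · rw [hW]; simp only [map_mul, mul_assoc]
    · simp only [mul_assoc]
    · rw [map_mul, hx₀, mul_assoc]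
    · rw [map_mul, hy₀, mul_assoc]
    · rw [FreeMonoid.length_mul]; omega
    · rw [FreeMonoid.length_mul]; omega
  rintro s w t ⟨hw, hwl⟩
  have hcut : ∀ v' v'', v = v' * v'' →
      S.IsInterpretation (u₁ * S.φ v' * (S.φ v'' * u₃)) s w t := by
    rintro v' v'' rfl
    exact ⟨by rw [hw]; simp only [map_mul, mul_assoc], hwl⟩
  -- An occurrence of a prefix `v'` of `v` at the right place of `w` extends letter by letter.
  have extend : ∀ v'' v' x z, v = v' * v'' → w = x * v' * z → S.φ x = s * u₁ →
      S.φ z = S.φ v'' * u₃ * t → ∃ y, w = x * v * y ∧ S.φ y = u₃ * t := by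
    intro v''
    induction v'' using FreeMonoid.inductionOn' with
    | one =>
      intro v' x z hv hwz hx hz
      exact ⟨z, by rw [hv, mul_one, hwz], by simpa using hz⟩
    | of_mul b v'' ih =>
      intro v' x z hv hwz hx hz
      have hv' : v = v' * FreeMonoid.of b * v'' := by rw [hv, mul_assoc]
      obtain ⟨-, a, ha⟩ := sync _ _ hv'
      -- The fixed interpretation shows that the synchronizing letter is `b`.
      obtain rfl : b = a := by
        obtain ⟨w', w'', e, hw', -, r, rfl⟩ := ha p (x₀ * v * y₀) q
          ⟨by rw [hW, hv']; simp only [map_mul, mul_assoc], hWl⟩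
        have h := S.left_eq_of_map_eq
          (a := x₀ * (v' * FreeMonoid.of b)) (b := v'' * y₀) (c := r * FreeMonoid.of a) (d := w'')
          (by rw [← e, hv']; simp only [mul_assoc])
          (by rw [hw', map_mul, hx₀, mul_assoc])
        rw [← mul_assoc] at h
        have h' := congrArg List.getLast? (show (x₀ * v').toList ++ [b] = r.toList ++ [a] from h)
        simpa using h'
      obtain ⟨w', w'', e, hw', hw'', r, rfl⟩ := ha s w t (hcut _ _ hv')
      have hr : r = x * v' := by
        refine S.left_eq_of_map_eq (b := FreeMonoid.of b * w'') (d := z) ?_ ?_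
        · rw [← hwz, e, mul_assoc]
        · have h : S.φ r * S.φ (FreeMonoid.of b) = s * u₁ * S.φ v' * S.φ (FreeMonoid.of b) := by
            rw [← map_mul, hw', map_mul]; simp only [mul_assoc]
          rw [mul_right_cancel h, map_mul, hx]
      exact ih _ x w'' hv' (by rw [e, hr]; simp only [mul_assoc]) hx hw''
  obtain ⟨-, a, ha⟩ := sync 1 v (one_mul v).symm
  obtain ⟨x, z, e, hx, hz, -⟩ := ha s w t (hcut 1 v (one_mul v).symm)
  rw [map_one, mul_one] at hx
  obtain ⟨y, hy, hy'⟩ := extend v 1 x z (one_mul v).symm (by rw [mul_one, e]) hx hz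
  exact ⟨x, y, hy, hx, hy'⟩

/-- The interpretations of a long word with respect to `φ ^ n` have a common cut. -/
theorem exists_synchronizing_cut_pow [Finite A] (hS : S.IsStronglyCircular) (n : ℕ) :
    ∃ D : ℕ, ∀ u ∈ S.lang, D < u.length → ∃ u' u'', u = u' * u'' ∧
      ∀ s w t, (S.φ ^ n) w = s * u * t → w ∈ S.lang →
        ∃ w' w'', w' * w'' = w ∧ (S.φ ^ n) w' = s * u' ∧ (S.φ ^ n) w'' = u'' * t := by
  induction n with
  | zero =>
    refine ⟨0, fun u _ _ => ⟨1, u, (one_mul u).symm, fun s w t h _ => ⟨s, u * t, ?_⟩⟩⟩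
    simp only [pow_zero, Monoid.End.coe_one, id_eq] at h ⊢
    exact ⟨by rw [h, mul_assoc], (mul_one s).symm, trivial⟩
  | succ n ih =>
    obtain ⟨N, hN⟩ := ih
    obtain ⟨K, hK⟩ := S.exists_common_desubstitution hS N
    refine ⟨K, fun u hu hlen => ?_⟩
    obtain ⟨u₁, v, u₃, rfl, hv, hvN, hint⟩ := hK u hu hlen
    obtain ⟨v', v'', rfl, hsync⟩ := hN v hv hvN
    refine ⟨u₁ * S.φ v', S.φ v'' * u₃, by simp only [map_mul, mul_assoc], fun s w t h hw => ?_⟩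
    rw [pow_succ', Monoid.End.coe_mul, Function.comp_apply] at h
    obtain ⟨x, y, hxy, hx, hy⟩ := hint s _ t ⟨h, S.map_pow_mem_lang hw n⟩
    obtain ⟨w', w'', e, hw', hw''⟩ := hsync x w y hxy hw
    refine ⟨w', w'', e, ?_, ?_⟩
    · rw [pow_succ', Monoid.End.coe_mul, Function.comp_apply, hw', map_mul, hx, mul_assoc]
    · rw [pow_succ', Monoid.End.coe_mul, Function.comp_apply, hw'', map_mul, hy, mul_assoc]

end PDF0LSystem

theorem mainTheorem4 {A : Type*} [Finite A] (S : PDF0LSystem A)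
    (hS : S.toDF0LSystem.IsStronglyCircular) (n : ℕ) (hn : 1 ≤ n) :
    (S.power n hn).toDF0LSystem.IsWeaklyCircular := by
  obtain ⟨D, hD⟩ := S.exists_synchronizing_cut_pow hS n
  refine ⟨D, fun u hu hlen => ?_⟩
  obtain ⟨u', u'', rfl, h⟩ := hD u (S.lang_power_subset n hn hu) hlen
  exact ⟨u', u'', rfl, fun s w t hi => h s w t hi.1 (S.lang_power_subset n hn hi.2)⟩
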